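/- Let $E=(E^0,E^1,s,r)$ be a finite directed graph (finite sets $E^0$ of vertices and $E^1$ of edges, with source and range maps $s,r\colon E^1\to E^0$; loops and parallel edges are allowed), and let $K$ be any field. Let $C_K(E)$ be the Cohn path algebra of $E$ over $K$, that is, the $K$-algebra generated by $E^0\cup E^1\cup\{e^*\mid e\in E^1\}$ subject to the relations, for all $v,w\in E^0$ and $e,f\in E^1$: (1) $vw=\delta_{v,w}w$; (2) $s(e)e=e=e\,r(e)$ and $r(e)e^*=e^*=e^*s(e)$; (3) $e^*f=\delta_{e,f}\,r(e)$. Since $E$ is finite, it is unital with $1=\sum_{v\in E^0}v$. A ring $R$ with identity has *Unbounded Generating Number* (UGN) if, for each positive integer $m$, every generating set of the free right $R$-module $R^m$ has at least $m$ elements. A vertex $v$ is a *source* if $r^{-1}(v)=\emptyset$. A *cycle* is a sequence of edges $e_1\cdots e_n$ with $n\ge 1$, $r(e_i)=s(e_{i+1})$ for $1\le i<n$, $r(e_n)=s(e_1)$, and $s(e_1),\dots,s(e_n)$ distinct; it is a *source cycle* if $|r^{-1}(v)|=1$ for each of its vertices $v=s(e_i)$. Then $C_K(E)$ has Unbounded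 Generating Number if and only if $E$ satisfies at least one of the following conditions: (1) $E$ contains a source; or (2) $E$ contains a source cycle. -/

import Mathlib

/-- A directed graph `E = (E⁰, E¹, s, r)` with vertex type `V = E⁰` and edge type `E = E¹`;
loops and parallel edges are allowed. -/
structure DirGraph (V E : Type*) where
  /-- the source of an edge -/
  s : E → V
  /-- the range of an edge -/
  r : E → V

namespace DirGraph

variable {V E : Type*} (G : DirGraph V E)

/-- A vertex is a source if no edge ends at it. -/
def IsSource (v : V) : Prop := {e : E | G.r e = v} = ∅

/-- A path (of positive length): a nonempty sequence of edges, each ending where the next begins. -/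
def IsPath (p : List E) : Prop := p ≠ [] ∧ p.IsChain (fun e f => G.r e = G.s f)

/-- A closed path: a path that ends at the vertex at which it starts. -/
def IsClosedPath (p : List E) : Prop := G.IsPath p ∧ p.head?.map G.s = p.getLast?.map G.r

/-- A cycle: a closed path `e₁ ⋯ eₙ` whose vertices `s(e₁), …, s(eₙ)` are distinct. -/
def IsCycle (c : List E) : Prop := G.IsClosedPath c ∧ (c.map G.s).Nodup

/-- A source cycle: a cycle each of whose vertices is the range of exactly one edge of the
graph. -/
def IsSourceCycle (c : List E) : Prop :=
  G.IsCycle c ∧ ∀ v ∈ c.map G.s, {e : E | G.r e = v}.encard = 1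

end DirGraph

/-- The generators of the Cohn path algebra: the vertices, the edges `e`, and the symbols `e*`. -/
inductive CohnGen (V E : Type*) where
  | vertex (v : V) : CohnGen V E
  | edge (e : E) : CohnGen V E
  | ghost (e : E) : CohnGen V E

namespace CohnGen

variable {V E : Type*} (K : Type*) [Field K]

/-- The vertex `v` as an element of the free unital algebra on the generators. -/
abbrev vtx (v : V) : FreeAlgebra K (CohnGen V E) := FreeAlgebra.ι K (vertex v)

/-- The edge `e` as an element of the free unital algebra on the generators. -/
abbrev edg (e : E) : FreeAlgebra K (CohnGen V E) := FreeAlgebra.ι K (edge e)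

/-- The symbol `e*` as an element of the free unital algebra on the generators. -/
abbrev gst (e : E) : FreeAlgebra K (CohnGen V E) := FreeAlgebra.ι K (ghost e)

end CohnGen

open CohnGen in
/-- The defining relations of the Cohn path algebra of a graph with finitely many vertices:
`v w = δ_{v,w} w`, `s(e) e = e = e r(e)`, `r(e) e* = e* = e* s(e)`, `e* f = δ_{e,f} r(e)`.
The relations (1)-(3) present a possibly non-unital algebra; when there are finitely many vertices
they force `∑ v` to be its identity element. Since we present it as a quotient of the free
*unital* algebra, the last constructor identifies the unit with `∑ v`. -/
inductive CohnRel {V E : Type*} [Fintype V] (K : Type*) [Field K] (G : DirGraph V E) :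
    FreeAlgebra K (CohnGen V E) → FreeAlgebra K (CohnGen V E) → Prop
  | vtx_mul_self (v : V) : CohnRel K G (vtx K v * vtx K v) (vtx K v)
  | vtx_mul_of_ne (v w : V) (h : v ≠ w) : CohnRel K G (vtx K v * vtx K w) 0
  | source_mul_edge (e : E) : CohnRel K G (vtx K (G.s e) * edg K e) (edg K e)
  | edge_mul_range (e : E) : CohnRel K G (edg K e * vtx K (G.r e)) (edg K e)
  | range_mul_ghost (e : E) : CohnRel K G (vtx K (G.r e) * gst K e) (gst K e)
  | ghost_mul_source (e : E) : CohnRel K G (gst K e * vtx K (G.s e)) (gst K e)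
  | ghost_mul_edge_self (e : E) : CohnRel K G (gst K e * edg K e) (vtx K (G.r e))
  | ghost_mul_edge_of_ne (e f : E) (h : e ≠ f) : CohnRel K G (gst K e * edg K f) 0
  | sum_vtx : CohnRel K G (∑ v : V, vtx K v) 1

/-- The Cohn path algebra `C_K(E)` of a graph with finitely many vertices, with coefficients
in the field `K`, as a unital `K`-algebra. -/
abbrev CohnPathAlgebra {V E : Type*} [Fintype V] (K : Type*) [Field K] (G : DirGraph V E) :=
  RingQuot (CohnRel K G)

/-- Unbounded Generating Number: for every positive integer `m`, every generating set of the free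
right `R`-module `R^m` has at least `m` elements. (Right `R`-modules are left modules over the
opposite ring.) -/
def HasUGN (R : Type*) [Ring R] : Prop :=
  ∀ m : ℕ, 0 < m → ∀ S : Set (Fin m → R), Submodule.span Rᵐᵒᵖ S = ⊤ → (m : ℕ∞) ≤ S.encard

/-! A source or a source cycle gives a nonempty vertex set W, closed under predecessors, such that
edges ending in W have distinct sources. Matrix units indexed by W then represent the algebra on the
nonzero space K^W, and comparing dimensions gives UGN (`hasUGN_of_set`, `HasUGN.of_ringHom_end`).

Otherwise choose an edge into every vertex and walk backwards. A walk meeting no vertex with a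
second incoming edge would eventually trace a source cycle, so every walk branches, and every vertex
w ends two distinct paths p_w, q_w of one common length. Paths of equal length are orthonormal under
p*q, so b = ∑ p_w and d = ∑ q_w with their ghosts a, c satisfy ab = cd = 1 and ad = cb = 0. Then (a,
c) alone generates R² (`not_hasUGN_of_mul_eq`). -/

/-- A ring with a nonzero finite-dimensional representation has Unbounded Generating Number. -/
theorem HasUGN.of_ringHom_end {R K M : Type*} [Ring R] [Field K] [AddCommGroup M] [Module K M]
    [FiniteDimensional K M] [Nontrivial M] (φ : R →+* Module.End K M) : HasUGN R := by
  classical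
  intro m _ S hS
  by_contra! hlt
  have hfin : S.Finite := Set.finite_of_encard_le_coe hlt.le
  have := hfin.fintype
  let act (u : Fin m → R) : M →ₗ[K] (Fin m → M) := LinearMap.pi fun i => φ (u i)
  let T : (S → M) →ₗ[K] (Fin m → M) := LinearMap.lsum K (fun _ => M) K fun u => act u
  -- Right scalars move into the argument, `act (u a) x = act u (φ a x)`, so the u satisfying this
  -- form a submodule containing S.
  have hT : ∀ u : Fin m → R, ∀ x, act u x ∈ LinearMap.range T := by
    intro u
    have hu : u ∈ Submodule.span Rᵐᵒᵖ S := hS ▸ Submodule.mem_top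
    induction hu using Submodule.span_induction with
    | mem u hu =>
      intro x
      refine ⟨Pi.single ⟨u, hu⟩ x, ?_⟩
      dsimp only [T]
      rw [LinearMap.lsum_apply, LinearMap.sum_apply, Finset.sum_eq_single ⟨u, hu⟩]
      · simp
      · intro b _ hb
        simp [hb]
      · simp
    | zero =>
      intro x
      have : act 0 x = 0 := by ext i; simp [act]
      rw [this]; exact zero_mem _
    | add u v _ _ hu hv =>
      intro x
      have : act (u + v) x = act u x + act v x := by ext i; simp [act]
      rw [this]; exact add_mem (hu x) (hv x)
    | smul a u _ hu =>
      intro x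
      have : act (a • u) x = act u (φ a.unop x) := by ext i; simp [act]
      rw [this]; exact hu _
  have hsurj : Function.Surjective T := by
    rw [← LinearMap.range_eq_top, eq_top_iff]
    intro y _
    have hy : y = ∑ i, act (Pi.single i 1) (y i) := by
      ext j
      rw [Finset.sum_apply, Finset.sum_eq_single j]
      · simp [act]
      · intro b _ hb
        simp [act, Pi.single_eq_of_ne hb.symm]
      · simp
    rw [hy]
    exact sum_mem fun i _ => hT _ _
  have hle := LinearMap.finrank_le_finrank_of_surjective hsurj
  rw [Module.finrank_pi_fintype, Module.finrank_pi_fintype] at hle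
  simp only [Finset.sum_const, Finset.card_univ, smul_eq_mul, Fintype.card_fin] at hle
  have hpos : 0 < Module.finrank K M := Module.finrank_pos
  have hcard := Nat.le_of_mul_le_mul_right hle hpos
  rw [Set.encard_eq_coe_toFinset_card, Set.toFinset_card] at hlt
  exact absurd (Nat.cast_lt.1 hlt) (not_lt.2 hcard)

/-- A ring `R` whose free right module `R²` is cyclic does not have Unbounded Generating Number. -/
theorem not_hasUGN_of_mul_eq {R : Type*} [Ring R] {a b c d : R} (hab : a * b = 1)
    (hcd : c * d = 1) (had : a * d = 0) (hcb : c * b = 0) : ¬ HasUGN R := by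
  intro h
  have hspan : Submodule.span Rᵐᵒᵖ {![a, c]} = ⊤ := by
    rw [eq_top_iff]
    intro y _
    rw [Submodule.mem_span_singleton]
    refine ⟨MulOpposite.op (b * y 0 + d * y 1), ?_⟩
    ext i
    fin_cases i
    · simp [mul_add, ← mul_assoc, hab, had]
    · simp [mul_add, ← mul_assoc, hcd, hcb]
  have := h 2 two_pos _ hspan
  simp at this

namespace CohnPathAlgebra

open CohnGen

section Generators

variable {V E : Type*} [Fintype V] (K : Type*) [Field K] (G : DirGraph V E)

/-- A vertex as an element of the Cohn path algebra. -/
noncomputable def vert (v : V) : CohnPathAlgebra K G := RingQuot.mkAlgHom K (CohnRel K G) (vtx K v)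

/-- An edge as an element of the Cohn path algebra. -/
noncomputable def edge (e : E) : CohnPathAlgebra K G := RingQuot.mkAlgHom K (CohnRel K G) (edg K e)

/-- A ghost edge as an element of the Cohn path algebra. -/
noncomputable def ghost (e : E) : CohnPathAlgebra K G :=
  RingQuot.mkAlgHom K (CohnRel K G) (gst K e)

theorem vert_mul_self (v : V) : vert K G v * vert K G v = vert K G v := by
  simpa [vert] using RingQuot.mkAlgHom_rel K (CohnRel.vtx_mul_self (K := K) (G := G) v)

theorem vert_mul_of_ne {v w : V} (h : v ≠ w) : vert K G v * vert K G w = 0 := by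
  simpa [vert] using RingQuot.mkAlgHom_rel K (CohnRel.vtx_mul_of_ne (K := K) (G := G) v w h)

theorem edge_mul_range (e : E) : edge K G e * vert K G (G.r e) = edge K G e := by
  simpa [vert, edge] using RingQuot.mkAlgHom_rel K (CohnRel.edge_mul_range (K := K) (G := G) e)

theorem ghost_mul_source (e : E) : ghost K G e * vert K G (G.s e) = ghost K G e := by
  simpa [vert, ghost] using RingQuot.mkAlgHom_rel K (CohnRel.ghost_mul_source (K := K) (G := G) e)

theorem ghost_mul_edge_self (e : E) : ghost K G e * edge K G e = vert K G (G.r e) := by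
  simpa [vert, edge, ghost] using
    RingQuot.mkAlgHom_rel K (CohnRel.ghost_mul_edge_self (K := K) (G := G) e)

theorem ghost_mul_edge_of_ne {e f : E} (h : e ≠ f) : ghost K G e * edge K G f = 0 := by
  simpa [edge, ghost] using
    RingQuot.mkAlgHom_rel K (CohnRel.ghost_mul_edge_of_ne (K := K) (G := G) e f h)

theorem sum_vert : ∑ v, vert K G v = 1 := by
  simpa [vert] using RingQuot.mkAlgHom_rel K (CohnRel.sum_vtx (K := K) (G := G))

end Generators

end CohnPathAlgebra

/-! ### Orthogonality of paths of equal length -/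

namespace DirGraph

/-- The list of edges, read backwards, forms a path that ends at the given vertex. -/
def IsPathTo {V E : Type*} (G : DirGraph V E) : List E → V → Prop
  | [], _ => True
  | e :: l, w => G.r e = w ∧ IsPathTo G l (G.s e)

end DirGraph

namespace CohnPathAlgebra

variable {V E : Type*} [Fintype V] (K : Type*) [Field K] (G : DirGraph V E)

/-- The element of the Cohn path algebra given by a path to `w`, with edges listed backwards. -/
noncomputable def path : List E → V → CohnPathAlgebra K G
  | [], w => vert K G w
  | e :: l, _ => path l (G.s e) * edge K G e

/-- The element of the Cohn path algebra given by the ghost of a path to `w`, with edges listed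
backwards. -/
noncomputable def ghostPath : List E → V → CohnPathAlgebra K G
  | [], w => vert K G w
  | e :: l, _ => ghost K G e * ghostPath l (G.s e)

theorem ghostPath_mul_path_self {l : List E} {w : V} (h : G.IsPathTo l w) :
    ghostPath K G l w * path K G l w = vert K G w := by
  induction l generalizing w with
  | nil => exact vert_mul_self K G w
  | cons e l ih =>
    obtain ⟨rfl, h⟩ := h
    calc ghost K G e * ghostPath K G l (G.s e) * (path K G l (G.s e) * edge K G e)
        = ghost K G e * (ghostPath K G l (G.s e) * path K G l (G.s e)) * edge K G e := by
          simp only [mul_assoc]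
      _ = _ := by rw [ih h, ghost_mul_source, ghost_mul_edge_self]

/-- The last edges are outermost in the product, so the induction strips them off. Equal length
matters: if one path were an initial segment of the other, the rest of the longer one would survive.
-/
theorem ghostPath_mul_path_of_ne {l l' : List E} {w w' : V} (h : G.IsPathTo l w)
    (h' : G.IsPathTo l' w') (hlen : l.length = l'.length) (hne : l ≠ l' ∨ w ≠ w') :
    ghostPath K G l w * path K G l' w' = 0 := by
  induction l generalizing w l' w' with
  | nil =>
    obtain rfl : l' = [] := List.length_eq_zero_iff.1 hlen.symm
    exact vert_mul_of_ne K G (by simpa using hne)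
  | cons e l ih =>
    cases l' with
    | nil => simp at hlen
    | cons e' l' =>
      obtain ⟨rfl, h⟩ := h
      obtain ⟨rfl, h'⟩ := h'
      have hassoc : ghostPath K G (e :: l) (G.r e) * path K G (e' :: l') (G.r e')
          = ghost K G e * (ghostPath K G l (G.s e) * path K G l' (G.s e')) * edge K G e' := by
        simp only [ghostPath, path, mul_assoc]
      rw [hassoc]
      by_cases hl : l ≠ l' ∨ G.s e ≠ G.s e'
      -- Either the remaining paths already differ, or they cancel and the last edges must differ.
      · rw [ih h h' (by simpa using hlen) hl, mul_zero, zero_mul]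
      · push Not at hl
        obtain ⟨rfl, hs⟩ := hl
        have hee : e ≠ e' := by
          rintro rfl
          simp at hne
        rw [← hs, ghostPath_mul_path_self K G h, ghost_mul_source, ghost_mul_edge_of_ne K G hee]

/-- If every vertex is the end of two distinct paths of a common length, then the Cohn path algebra
does not have Unbounded Generating Number. -/
theorem not_hasUGN_of_paths (k : ℕ) (p q : V → List E) (hp : ∀ w, G.IsPathTo (p w) w)
    (hq : ∀ w, G.IsPathTo (q w) w) (hpk : ∀ w, (p w).length = k) (hqk : ∀ w, (q w).length = k)
    (hpq : ∀ w, p w ≠ q w) : ¬ HasUGN (CohnPathAlgebra K G) := by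
  have self (p : V → List E) (hp : ∀ w, G.IsPathTo (p w) w) (hpk : ∀ w, (p w).length = k) :
      (∑ w, ghostPath K G (p w) w) * ∑ w, path K G (p w) w = 1 := by
    rw [Finset.sum_mul_sum, ← sum_vert K G]
    refine Finset.sum_congr rfl fun w _ => ?_
    rw [Finset.sum_eq_single w, ghostPath_mul_path_self K G (hp w)]
    · intro w' _ hw
      exact ghostPath_mul_path_of_ne K G (hp w) (hp w') ((hpk w).trans (hpk w').symm) (.inr hw.symm)
    · simp
  have cross (p q : V → List E) (hp : ∀ w, G.IsPathTo (p w) w) (hq : ∀ w, G.IsPathTo (q w) w)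
      (hpk : ∀ w, (p w).length = k) (hqk : ∀ w, (q w).length = k) (hpq : ∀ w, p w ≠ q w) :
      (∑ w, ghostPath K G (p w) w) * ∑ w, path K G (q w) w = 0 := by
    rw [Finset.sum_mul_sum]
    refine Finset.sum_eq_zero fun w _ => Finset.sum_eq_zero fun w' _ => ?_
    refine ghostPath_mul_path_of_ne K G (hp w) (hq w') ((hpk w).trans (hqk w').symm) ?_
    by_cases hw : w = w'
    · exact .inl (hw ▸ hpq w)
    · exact .inr hw
  exact not_hasUGN_of_mul_eq (self p hp hpk) (self q hq hqk) (cross p q hp hq hpk hqk hpq)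
    (cross q p hq hp hqk hpk fun w => (hpq w).symm)

end CohnPathAlgebra

/-! ### Backward walks and source cycles -/

namespace DirGraph

section Backtracking

variable {V E : Type*} (G : DirGraph V E) {f : V → E}

theorem exists_isPathTo (hf : ∀ w, G.r (f w) = w) (k : ℕ) (w : V) :
    ∃ l, G.IsPathTo l w ∧ l.length = k := by
  induction k generalizing w with
  | zero => exact ⟨[], trivial, rfl⟩
  | succ k ih =>
    obtain ⟨l, hl, hk⟩ := ih (G.s (f w))
    exact ⟨f w :: l, ⟨hf w, hl⟩, by simp [hk]⟩

/-- If the backward walk from `w` reaches a vertex with a second incoming edge, then `w` is the end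
of two distinct paths of any larger length. -/
theorem exists_isPathTo_ne (hf : ∀ w, G.r (f w) = w) (i : ℕ) :
    ∀ (k : ℕ) (w : V), i < k → (∃ e, G.r e = (fun v => G.s (f v))^[i] w ∧
      e ≠ f ((fun v => G.s (f v))^[i] w)) →
    ∃ l l', G.IsPathTo l w ∧ G.IsPathTo l' w ∧ l.length = k ∧ l'.length = k ∧ l ≠ l' := by
  induction i with
  | zero =>
    rintro (_ | k) w hk ⟨e, he, hne⟩
    · simp at hk
    · obtain ⟨l, hl, hlk⟩ := G.exists_isPathTo hf k (G.s e)
      obtain ⟨l', hl', hlk'⟩ := G.exists_isPathTo hf k (G.s (f w))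
      exact ⟨e :: l, f w :: l', ⟨he, hl⟩, ⟨hf w, hl'⟩, by simp [hlk], by simp [hlk'],
        fun h => hne (List.cons.inj h).1⟩
  | succ i ih =>
    rintro (_ | k) w hk he
    · simp at hk
    · obtain ⟨l, l', hl, hl', hlk, hlk', hne⟩ := ih k (G.s (f w)) (by omega) (by simpa using he)
      exact ⟨f w :: l, f w :: l', ⟨hf w, hl⟩, ⟨hf w, hl'⟩, by simp [hlk], by simp [hlk'],
        fun h => hne (List.cons.inj h).2⟩

/-- If all the vertices on the backward walk from `w` have a single incoming edge, then the graph
has a source cycle. -/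
theorem exists_isSourceCycle [Finite V] (hf : ∀ w, G.r (f w) = w) (w : V)
    (h : ∀ i e, G.r e = (fun v => G.s (f v))^[i] w → e = f ((fun v => G.s (f v))^[i] w)) :
    ∃ c, G.IsSourceCycle c := by
  set g : V → V := fun v => G.s (f v) with hg
  obtain ⟨i, j, hij, heq⟩ := Finite.exists_ne_map_eq_of_infinite fun i : ℕ => g^[i] w
  wlog hlt : i < j generalizing i j
  · exact this j i hij.symm heq.symm (by omega)
  set x := g^[i] w with hx
  have hper : Function.IsPeriodicPt g (j - i) x := by
    change g^[j - i] x = x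
    rw [hx, ← Function.iterate_add_apply, Nat.sub_add_cancel hlt.le]
    exact heq.symm
  have hpos : 0 < Function.minimalPeriod g x := hper.minimalPeriod_pos (by omega)
  set n := Function.minimalPeriod g x with hn
  have hgn : g^[n] x = x := Function.iterate_minimalPeriod
  have hsucc (k : ℕ) : G.s (f (g^[k] x)) = g^[k + 1] x := by rw [Function.iterate_succ_apply']
  -- The orbit of x under `g` runs against the edges, hence the reversal.
  refine ⟨((List.range n).map fun k => f (g^[k] x)).reverse, ⟨⟨⟨?_, ?_⟩, ?_⟩, ?_⟩, ?_⟩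
  · simp [hpos.ne']
  · rw [List.isChain_reverse, List.isChain_map, List.isChain_iff_getElem]
    intro k hk
    simp [hf, hsucc]
  · obtain ⟨n', hn'⟩ := Nat.exists_eq_succ_of_ne_zero hpos.ne'
    rw [List.head?_reverse, List.getLast?_reverse, hn']
    rw [hn'] at hgn
    simp [List.getLast?_range, List.head?_range, hsucc, hf, hgn]
  · rw [List.map_reverse, List.nodup_reverse, List.map_map]
    refine List.Nodup.map_on ?_ List.nodup_range
    intro a ha b hb hab
    rw [List.mem_range] at ha hb
    simp only [Function.comp_apply, hsucc] at hab
    -- The sources are g^(k+1) x = g^k (g x), so distinctness is read off the orbit of g x.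
    have hmin : Function.minimalPeriod g (g x) = n :=
      Function.minimalPeriod_apply (Function.minimalPeriod_pos_iff_mem_periodicPts.1 hpos)
    exact (Function.iterate_eq_iterate_iff_of_lt_minimalPeriod (hmin ▸ ha) (hmin ▸ hb)).1 hab
  · intro v hv
    simp only [List.map_reverse, List.mem_reverse, List.map_map, List.mem_map, List.mem_range,
      Function.comp_apply, hsucc] at hv
    obtain ⟨k, -, rfl⟩ := hv
    rw [Set.encard_eq_one]
    refine ⟨f (g^[k + 1] x), ?_⟩
    ext e
    simp only [Set.mem_ofPred_eq, Set.mem_singleton_iff]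
    constructor
    · intro he
      rw [hx, ← Function.iterate_add_apply] at he ⊢
      exact h _ e he
    · rintro rfl
      exact hf _

end Backtracking

end DirGraph

namespace CohnPathAlgebra

theorem not_hasUGN {V E : Type*} [Fintype V] (G : DirGraph V E) (K : Type*) [Field K]
    (hs : ∀ v, ¬ G.IsSource v) (hc : ∀ c, ¬ G.IsSourceCycle c) :
    ¬ HasUGN (CohnPathAlgebra K G) := by
  have hne : ∀ v, ∃ e, G.r e = v := fun v => Set.nonempty_iff_ne_empty.2 (hs v)
  choose f hf using hne
  have hbranch : ∀ w, ∃ i, ∃ e, G.r e = (fun v => G.s (f v))^[i] w ∧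
      e ≠ f ((fun v => G.s (f v))^[i] w) := by
    intro w
    by_contra! hw
    obtain ⟨c, hc'⟩ := G.exists_isSourceCycle hf w hw
    exact hc c hc'
  choose i hi using hbranch
  -- The supremum plus one is a single length exceeding every branching time `i w`.
  have hpaths := fun w => G.exists_isPathTo_ne hf (i w) (Finset.univ.sup i + 1) w
    (Nat.lt_succ_of_le (Finset.le_sup (Finset.mem_univ w))) (hi w)
  choose p q hp hq hpk hqk hpq using hpaths
  exact not_hasUGN_of_paths K G _ p q hp hq hpk hqk hpq

/-! ### Matrix representations -/

section Representation

variable {V : Type*} (K : Type*) [Field K] (W : Set V)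

open Classical in
/-- The matrix unit with indices `a` and `b`, or zero if one of them is outside `W`. -/
noncomputable def unitAt (a b : V) : Matrix W W K :=
  if h : a ∈ W ∧ b ∈ W then Matrix.single ⟨a, h.1⟩ ⟨b, h.2⟩ 1 else 0

variable {W}

theorem unitAt_of_notMem {a b : V} (h : a ∈ W → b ∉ W) : unitAt K W a b = 0 := by
  rw [unitAt, dif_neg]
  exact fun h' => h h'.1 h'.2

theorem unitAt_mul_of_ne [Fintype W] (a d : V) {b c : V} (h : b ≠ c) :
    unitAt K W a b * unitAt K W c d = 0 := by
  classical
  unfold unitAt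
  split_ifs
  · exact Matrix.single_mul_single_of_ne _ _ _ _ (by simpa using h) _
  all_goals simp

/-- If a or d lies outside W, both sides vanish whatever b is. -/
theorem unitAt_mul [Fintype W] {a b d : V} (h : a ∈ W → d ∈ W → b ∈ W) :
    unitAt K W a b * unitAt K W b d = unitAt K W a d := by
  classical
  by_cases had : a ∈ W ∧ d ∈ W
  · have hb := h had.1 had.2
    simp [unitAt, had, hb]
  · rw [unitAt_of_notMem K (a := a) (b := d) (by tauto)]
    by_cases ha : a ∈ W
    · rw [unitAt_of_notMem K (a := b) (b := d) (by tauto), mul_zero]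
    · rw [unitAt_of_notMem K (a := a) (b := b) (by tauto), zero_mul]

open Classical in
theorem sum_unitAt [Fintype V] : ∑ v, unitAt K W v v = 1 := by
  ext i j
  rw [Matrix.sum_apply, Finset.sum_eq_single i.1]
  · rw [unitAt, dif_pos ⟨i.2, i.2⟩, Matrix.single_apply, Matrix.one_apply]
    simp
  · intro v _ hv
    unfold unitAt
    split_ifs with h
    · rw [Matrix.single_apply, if_neg]
      rintro ⟨rfl, -⟩
      exact hv rfl
    · rfl
  · simp

end Representation

/-- If `W` is a nonempty set of vertices such that every edge ending in `W` starts in `W` and no two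
such edges have the same source, then the Cohn path algebra has Unbounded Generating Number. -/
theorem hasUGN_of_set {V E : Type*} [Fintype V] (G : DirGraph V E) (K : Type*) [Field K] (W : Set V)
    (hW : W.Nonempty) (hs : ∀ e, G.r e ∈ W → G.s e ∈ W)
    (hinj : ∀ e f, G.r e ∈ W → G.r f ∈ W → G.s e = G.s f → e = f) :
    HasUGN (CohnPathAlgebra K G) := by
  classical
  have := hW.to_subtype
  let φ : FreeAlgebra K (CohnGen V E) →ₐ[K] Matrix W W K := FreeAlgebra.lift K fun
    | .vertex v => unitAt K W v v
    | .edge e => unitAt K W (G.s e) (G.r e)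
    | .ghost e => unitAt K W (G.r e) (G.s e)
  have hφ : ∀ ⦃x y⦄, CohnRel K G x y → φ x = φ y := by
    intro x y h
    induction h with
    | vtx_mul_self v => simpa [φ] using unitAt_mul K (by simp)
    | vtx_mul_of_ne v w h => simpa [φ] using unitAt_mul_of_ne K v w h
    | source_mul_edge e => simpa [φ] using unitAt_mul K (by tauto)
    | edge_mul_range e => simpa [φ] using unitAt_mul K (by tauto)
    | range_mul_ghost e => simpa [φ] using unitAt_mul K (by tauto)
    | ghost_mul_source e => simpa [φ] using unitAt_mul K (by tauto)
    -- Here alone the middle index s(e) is not an outer one, so closure under predecessors is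
    -- needed.
    | ghost_mul_edge_self e => simpa [φ] using unitAt_mul K fun h _ => hs e h
    | ghost_mul_edge_of_ne e f h =>
      suffices unitAt K W (G.r e) (G.s e) * unitAt K W (G.s f) (G.r f) = 0 by simpa [φ] using this
      by_cases he : G.r e ∈ W
      · by_cases hf : G.r f ∈ W
        · exact unitAt_mul_of_ne K _ _ fun hef => h (hinj e f he hf hef)
        · rw [unitAt_of_notMem K fun _ => hf, mul_zero]
      · rw [unitAt_of_notMem K fun h => absurd h he, zero_mul]
    | sum_vtx => simpa [φ] using sum_unitAt K
  let ψ : CohnPathAlgebra K G →ₐ[K] Matrix W W K := RingQuot.liftAlgHom K ⟨φ, hφ⟩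
  exact HasUGN.of_ringHom_end
    (Matrix.toLinAlgEquiv' (R := K) (n := W) |>.toAlgHom.comp ψ).toRingHom

end CohnPathAlgebra

namespace DirGraph

/-- The required edge is the predecessor of e in p; for the first edge it is the last one. -/
theorem IsClosedPath.exists_range_eq {V E : Type*} {G : DirGraph V E} {p : List E}
    (hc : G.IsClosedPath p) {e : E} (he : e ∈ p) : ∃ f ∈ p, G.r f = G.s e := by
  obtain ⟨⟨hne, hchain⟩, hclosed⟩ := hc
  obtain ⟨i, hi, rfl⟩ := List.getElem_of_mem he
  rcases i with _ | i
  · refine ⟨p.getLast hne, List.getLast_mem hne, ?_⟩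
    rw [List.getLast?_eq_some_getLast hne, List.head?_eq_getElem?,
      List.getElem?_eq_getElem hi] at hclosed
    simpa using hclosed.symm
  · exact ⟨p[i], List.getElem_mem _, List.isChain_iff_getElem.1 hchain i hi⟩

/-- The cycle itself supplies an edge into r(e), and only one edge ends there. -/
theorem IsSourceCycle.mem_of_range_mem {V E : Type*} {G : DirGraph V E} {c : List E}
    (hc : G.IsSourceCycle c) {e : E} (he : G.r e ∈ c.map G.s) : e ∈ c := by
  obtain ⟨e', he', h⟩ := List.mem_map.1 he
  obtain ⟨f, hf, hfe⟩ := hc.1.1.exists_range_eq he'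
  obtain ⟨a, ha⟩ := Set.encard_eq_one.1 (hc.2 _ he)
  have h1 : e ∈ {e' : E | G.r e' = G.r e} := rfl
  have h2 : f ∈ {e' : E | G.r e' = G.r e} := hfe.trans h
  rw [ha] at h1 h2
  rw [Set.mem_singleton_iff.1 h1, ← Set.mem_singleton_iff.1 h2]
  exact hf

end DirGraph

theorem corollary4p11 {V E : Type*} [Fintype V] [Finite E] (G : DirGraph V E)
    (K : Type*) [Field K] :
    HasUGN (CohnPathAlgebra K G) ↔
      (∃ v : V, G.IsSource v) ∨ (∃ c : List E, G.IsSourceCycle c) := by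
  constructor
  · intro h
    by_contra! hcon
    exact CohnPathAlgebra.not_hasUGN G K hcon.1 hcon.2 h
  · rintro (⟨v, hv⟩ | ⟨c, hc⟩)
    · have hr (e : E) : G.r e ∉ ({v} : Set V) := fun he => Set.eq_empty_iff_forall_notMem.1 hv e he
      exact CohnPathAlgebra.hasUGN_of_set G K {v} (Set.singleton_nonempty v)
        (fun e he => absurd he (hr e)) fun e _ he => absurd he (hr e)
    · refine CohnPathAlgebra.hasUGN_of_set G K {v | v ∈ c.map G.s} ?_ ?_ ?_
      · obtain ⟨e, he⟩ := List.exists_mem_of_ne_nil c hc.1.1.1.1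
        exact ⟨G.s e, List.mem_map_of_mem he⟩
      · exact fun e he => List.mem_map_of_mem (hc.mem_of_range_mem he)
      · exact fun e f he hf => List.inj_on_of_nodup_map hc.1.2 (hc.mem_of_range_mem he)
          (hc.mem_of_range_mem hf)
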